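/- Let $n \ge 3$ and $R = \mathbb{Z}[t^{\pm1},q^{\pm1}]$. For $m\ge 1$ let $\mathbf{B}_m$ be the braid group with Artin generators $\sigma_1,\dots,\sigma_{m-1}$, let $\mathrm{id}_1\natural - : \mathbf{B}_m\to\mathbf{B}_{m+1}$ be the morphism $\sigma_i\mapsto\sigma_{i+1}$, and for a unit $r\in R^\times$ let $R_r$ be the representation of $\mathbf{B}_m$ on $R$ in which every $\sigma_i$ acts as multiplication by $r$. For a unit $u \in R^\times$ let $\mathrm{Bur}_{m,u}:\mathbf{B}_m\to GL_m(R)$ be the unreduced Burau representation $\sigma_i\mapsto I_{i-1}\oplus\begin{pmatrix}0&u\\1&1-u\end{pmatrix}\oplus I_{m-i-1}$, and let $\mathrm{TYM}_m:\mathbf{B}_m\to GL_m(R)$ be the Tong-Yang-Ma representation $\sigma_i\mapsto I_{i-1}\oplus\begin{pmatrix}0&1\\t&0\end{pmatrix}\oplus I_{m-i-1}$. Let $\mathbf{F}_m$ be the free group on $x_1,\dots,x_m$ and $\mathcal{I}_{\mathbf{F}_m}$ the augmentation ideal of $\mathbb{Z}[\mathbf{F}_m]$. Let $a_m:\mathbf{B}_m\to\mathrm{Aut}(\mathbf{F}_m)$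 be the Artin homomorphism, for which $\sigma_i$ sends $x_i$ to $x_{i+1}$, $x_{i+1}$ to $x_{i+1}^{-1}x_ix_{i+1}$, and fixes the other $x_j$. Let $\chi_m:\mathbf{F}_m\to\mathbf{B}_{m+1}$ be given by $x_i\mapsto(\sigma_{i-1}\cdots\sigma_1)^{-1}\sigma_i^2(\sigma_{i-1}\cdots\sigma_1)$. For a representation $\rho$ of $\mathbf{B}_{m+1}$ on an $R$-module $V$, let $\mathbf{F}_m$ act on $V$ through $\rho\circ\chi_m$; the Long-Moody construction $\mathbf{LM}(\rho)$ is the representation of $\mathbf{B}_m$ on $\mathcal{I}_{\mathbf{F}_m}\otimes_{\mathbf{F}_m}V$ given by $\lambda\cdot(i\otimes v)=a_m(\lambda)(i)\otimes\rho(\mathrm{id}_1\natural\lambda)(v)$. Put $$\mathbf{LM}_q(\mathrm{TYM}_{m+1}) = R_{q^{-1}}\otimes_R\mathbf{LM}(R_q\otimes_R\mathrm{TYM}_{m+1}),$$ a representation of $\mathbf{B}_m$, and let $\tau_1\mathbf{LM}_q(\mathrm{TYM}_{n+1})$ be the representation of $\mathbf{B}_n$ obtained by restricting the representation $\mathbf{LM}_q(\mathrm{TYM}_{n+2})$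 of $\mathbf{B}_{n+1}$ along $\mathrm{id}_1\natural -:\mathbf{B}_n\to\mathbf{B}_{n+1}$. Theorem 5.3. There is a surjective $R$-linear $\mathbf{B}_n$-equivariant map from $\tau_1\mathbf{LM}_q(\mathrm{TYM}_{n+1})$ onto $\mathrm{Bur}_{n,q^2}$, and $$\mathrm{Ker}\bigl(\tau_1\mathbf{LM}_q(\mathrm{TYM}_{n+1})\bigr)\subseteq\mathrm{Ker}\bigl(\mathrm{Bur}_{n,q^2}\bigr).$$ -/

import Mathlib

open scoped TensorProduct LaurentPolynomial

noncomputable section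

namespace LongMoody

/-! ### The braid group -/

/-- The Artin relators on the letters `σ_0, …, σ_{n-2}` (indices are shifted down by one
with respect to the usual `σ_1, …, σ_{n-1}`). -/
inductive BraidRel (n : ℕ) : FreeGroup (Fin (n - 1)) → Prop
  | comm (i j : Fin (n - 1)) (h : i.val + 2 ≤ j.val) :
      BraidRel n (FreeGroup.of i * FreeGroup.of j *
        (FreeGroup.of j * FreeGroup.of i)⁻¹)
  | braid (i j : Fin (n - 1)) (h : i.val + 1 = j.val) :
      BraidRel n (FreeGroup.of i * FreeGroup.of j * FreeGroup.of i *
        (FreeGroup.of j * FreeGroup.of i * FreeGroup.of j)⁻¹)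

/-- The braid group on `n` strands, by its Artin presentation. -/
abbrev BraidGroup (n : ℕ) : Type := PresentedGroup {r | BraidRel n r}

namespace BraidGroup

/-- The Artin generators; `σ i` is the generator usually called `σ_{i+1}`. -/
def σ {n : ℕ} (i : Fin (n - 1)) : BraidGroup n := PresentedGroup.of i

theorem σ_comm {n : ℕ} (i j : Fin (n - 1)) (h : i.val + 2 ≤ j.val) :
    σ i * σ j = σ j * σ i := by
  have := PresentedGroup.one_of_mem (rels := {r | BraidRel n r}) (BraidRel.comm i j h)
  rw [map_mul, map_inv, mul_inv_eq_one, map_mul, map_mul] at this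
  exact this

theorem σ_braid {n : ℕ} (i j : Fin (n - 1)) (h : i.val + 1 = j.val) :
    σ i * σ j * σ i = σ j * σ i * σ j := by
  have := PresentedGroup.one_of_mem (rels := {r | BraidRel n r}) (BraidRel.braid i j h)
  rw [map_mul, map_inv, mul_inv_eq_one, map_mul, map_mul, map_mul, map_mul] at this
  exact this

/-- The universal property of the Artin presentation. -/
def lift {n : ℕ} {G : Type*} [Group G] (f : Fin (n - 1) → G)
    (hc : ∀ i j : Fin (n - 1), i.val + 2 ≤ j.val → f i * f j = f j * f i)
    (hb : ∀ i j : Fin (n - 1), i.val + 1 = j.val → f i * f j * f i = f j * f i * f j) :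
    BraidGroup n →* G :=
  PresentedGroup.toGroup (f := f) (rels := {r | BraidRel n r}) (by
    rintro r (⟨i, j, h⟩ | ⟨i, j, h⟩)
    · rw [map_mul, map_inv, mul_inv_eq_one]
      simpa using hc i j h
    · rw [map_mul, map_inv, mul_inv_eq_one]
      simpa using hb i j h)

@[simp] theorem lift_σ {n : ℕ} {G : Type*} [Group G] (f : Fin (n - 1) → G) (hc) (hb)
    (i : Fin (n - 1)) : lift f hc hb (σ i) = f i :=
  PresentedGroup.toGroup.of _

/-- The morphism `id_1 ♮ - : B_n → B_{n+1}`, sending each generator to the next one. -/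
def shift (n : ℕ) : BraidGroup n →* BraidGroup (n + 1) :=
  lift (fun i => σ ⟨i.val + 1, by omega⟩)
    (fun i j h => σ_comm _ _ (by simp only; omega))
    (fun i j h => σ_braid _ _ (by simp only; omega))

/-- The character of `B_n` that sends every Artin generator to `r`. -/
def character (n : ℕ) {R : Type*} [CommRing R] (r : Rˣ) : BraidGroup n →* Rˣ :=
  lift (fun _ => r) (fun _ _ _ => rfl) (fun _ _ _ => rfl)

/-- The left strand position `i` that the generator `σ i` acts on. -/
def posL {n : ℕ} (i : Fin (n - 1)) : Fin n := ⟨i.val, by omega⟩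

/-- The right strand position `i + 1` that the generator `σ i` acts on. -/
def posR {n : ℕ} (i : Fin (n - 1)) : Fin n := ⟨i.val + 1, by omega⟩

theorem posL_ne_posR {n : ℕ} (i : Fin (n - 1)) : posL i ≠ posR i := by
  simp [posL, posR, Fin.ext_iff]

end BraidGroup

open BraidGroup

/-! ### The Burau and the Tong-Yang-Ma representations -/

section Matrices

variable {R : Type*} [CommRing R]

/-- The `n × n` matrix that agrees with the identity except that its entries with both indices
in `{a, b}` are those of the `2 × 2` matrix `A`. For `a = i`, `b = i + 1` this is
`I ⊕ A ⊕ I`. -/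
def block {n : ℕ} (a b : Fin n) (A : Matrix (Fin 2) (Fin 2) R) : Matrix (Fin n) (Fin n) R :=
  Matrix.of fun r c =>
    if r = a ∧ c = a then A 0 0
    else if r = a ∧ c = b then A 0 1
    else if r = b ∧ c = a then A 1 0
    else if r = b ∧ c = b then A 1 1
    else if r = c then 1 else 0

theorem block_mulVec {n : ℕ} {a b : Fin n} (hab : a ≠ b) (A : Matrix (Fin 2) (Fin 2) R)
    (v : Fin n → R) (r : Fin n) :
    (block a b A).mulVec v r =
      if r = a then A 0 0 * v a + A 0 1 * v b
      else if r = b then A 1 0 * v a + A 1 1 * v b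
      else v r := by
  have key : ∀ c, block a b A r c =
      if r = a then (if c = a then A 0 0 else 0) + (if c = b then A 0 1 else 0)
      else if r = b then (if c = a then A 1 0 else 0) + (if c = b then A 1 1 else 0)
      else if c = r then 1 else 0 := by
    intro c
    simp only [block, Matrix.of_apply]
    grind
  simp only [Matrix.mulVec, dotProduct, key]
  split_ifs <;> simp [add_mul, Finset.sum_add_distrib]

theorem matrix_ext_mulVec {n : ℕ} {A B : Matrix (Fin n) (Fin n) R}
    (h : ∀ v r, A.mulVec v r = B.mulVec v r) : A = B :=
  Matrix.mulVec_injective (funext fun v => funext fun r => h v r)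

/-- `A ↦ block a b A` is multiplicative. -/
def blockHom {n : ℕ} (a b : Fin n) (hab : a ≠ b) :
    Matrix (Fin 2) (Fin 2) R →* Matrix (Fin n) (Fin n) R where
  toFun := block a b
  map_one' := by
    refine matrix_ext_mulVec fun v r => ?_
    rw [block_mulVec hab]
    simp
    grind
  map_mul' A B := by
    refine matrix_ext_mulVec fun v r => ?_
    rw [← Matrix.mulVec_mulVec]
    simp only [block_mulVec hab, Matrix.mul_apply, Fin.sum_univ_two]
    grind

/-- The invertible matrix `I_i ⊕ A ⊕ I_{n-i-2}`, with `A` in rows and columns `i, i + 1`. -/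
def blockGL {n : ℕ} (i : Fin (n - 1)) (A : GL (Fin 2) R) : GL (Fin n) R :=
  Units.map (blockHom (posL i) (posR i) (posL_ne_posR i)) A

theorem blockGL_val {n : ℕ} (i : Fin (n - 1)) (A : GL (Fin 2) R) :
    (blockGL i A).val = block (posL i) (posR i) A.val := rfl

theorem blockGL_comm {n : ℕ} (A : GL (Fin 2) R) (i j : Fin (n - 1)) (h : i.val + 2 ≤ j.val) :
    blockGL i A * blockGL j A = blockGL j A * blockGL i A := by
  refine Units.ext (matrix_ext_mulVec fun v r => ?_)
  have h1 : posL i ≠ posL j := by simp [posL, Fin.ext_iff]; omega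
  have h2 : posL i ≠ posR j := by simp [posL, posR, Fin.ext_iff]; omega
  have h3 : posR i ≠ posL j := by simp [posL, posR, Fin.ext_iff]; omega
  have h4 : posR i ≠ posR j := by simp [posR, Fin.ext_iff]; omega
  simp only [Units.val_mul, blockGL_val, ← Matrix.mulVec_mulVec,
    block_mulVec (posL_ne_posR _)]
  grind

/-- The `2 × 2` block `(0 u; 1 1-u)`. -/
def burauBlock (u : Rˣ) : GL (Fin 2) R where
  val := !![0, (u : R); 1, 1 - (u : R)]
  inv := !![1 - (↑u⁻¹ : R), 1; (↑u⁻¹ : R), 0]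
  val_inv := by
    ext i j
    fin_cases i <;> fin_cases j <;> simp [Matrix.mul_apply, Fin.sum_univ_two, sub_mul]
  inv_val := by
    ext i j
    fin_cases i <;> fin_cases j <;> simp [Matrix.mul_apply, Fin.sum_univ_two, mul_sub, sub_mul]

/-- The `2 × 2` block `(0 1; u 0)`. -/
def tymBlock (u : Rˣ) : GL (Fin 2) R where
  val := !![0, 1; (u : R), 0]
  inv := !![0, (↑u⁻¹ : R); 1, 0]
  val_inv := by
    ext i j
    fin_cases i <;> fin_cases j <;> simp [Matrix.mul_apply, Fin.sum_univ_two]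
  inv_val := by
    ext i j
    fin_cases i <;> fin_cases j <;> simp [Matrix.mul_apply, Fin.sum_univ_two]

/-- The unreduced Burau representation `Bur_{n,u} : B_n → GL_n(R)` with parameter `u`,
`σ_i ↦ I ⊕ (0 u; 1 1-u) ⊕ I`. -/
def burau (n : ℕ) (u : Rˣ) : BraidGroup n →* GL (Fin n) R :=
  lift (fun i => blockGL i (burauBlock u)) (blockGL_comm _) (by
    intro i j h
    refine Units.ext (matrix_ext_mulVec fun v r => ?_)
    have h1 : posR i = posL j := by simp [posL, posR, h]
    have h2 : posL i ≠ posR j := by simp [posL, posR, Fin.ext_iff]; omega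
    have h3 := posL_ne_posR i
    have h4 := posL_ne_posR j
    simp only [Units.val_mul, blockGL_val, ← Matrix.mulVec_mulVec,
      block_mulVec (posL_ne_posR _), burauBlock, Matrix.of_apply, Matrix.cons_val',
      Matrix.cons_val_zero, Matrix.cons_val_one, Matrix.cons_val_fin_one]
    grind)

/-- The Tong-Yang-Ma representation `TYM_n : B_n → GL_n(R)` with parameter `u`,
`σ_i ↦ I ⊕ (0 1; u 0) ⊕ I`. -/
def tym (n : ℕ) (u : Rˣ) : BraidGroup n →* GL (Fin n) R :=
  lift (fun i => blockGL i (tymBlock u)) (blockGL_comm _) (by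
    intro i j h
    refine Units.ext (matrix_ext_mulVec fun v r => ?_)
    have h1 : posR i = posL j := by simp [posL, posR, h]
    have h2 : posL i ≠ posR j := by simp [posL, posR, Fin.ext_iff]; omega
    have h3 := posL_ne_posR i
    have h4 := posL_ne_posR j
    simp only [Units.val_mul, blockGL_val, ← Matrix.mulVec_mulVec,
      block_mulVec (posL_ne_posR _), tymBlock, Matrix.of_apply, Matrix.cons_val',
      Matrix.cons_val_zero, Matrix.cons_val_one, Matrix.cons_val_fin_one]
    grind)

/-- A morphism to `GL_m(R)` as a linear representation on column vectors. -/
def matrixRep {G : Type*} [Group G] {m : ℕ} (ρ : G →* GL (Fin m) R) :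
    Representation R G (Fin m → R) :=
  (Matrix.toLinAlgEquiv' : Matrix (Fin m) (Fin m) R ≃ₐ[R] _).toMonoidHom.comp
    ((Units.coeHom _).comp ρ)

/-- The one-dimensional representation of `B_n` on `R` in which every Artin generator acts by
multiplication by `r`. -/
def oneDim (n : ℕ) (r : Rˣ) : Representation R (BraidGroup n) R :=
  (Algebra.lmul R R : R →* Module.End R R).comp ((Units.coeHom R).comp (character n r))

end Matrices

/-! ### The Artin action on the free group and the map to the braid group -/

/-- The automorphism `x_a ↦ x_b`, `x_b ↦ x_b⁻¹ x_a x_b`, `x_j ↦ x_j` for `j ≠ a, b`. -/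
def artinAut {n : ℕ} (a b : Fin n) (hab : a ≠ b) : MulAut (FreeGroup (Fin n)) :=
  MonoidHom.toMulEquiv
    (FreeGroup.lift fun j => if j = a then FreeGroup.of b
      else if j = b then (FreeGroup.of b)⁻¹ * FreeGroup.of a * FreeGroup.of b
      else FreeGroup.of j)
    (FreeGroup.lift fun j => if j = b then FreeGroup.of a
      else if j = a then FreeGroup.of a * FreeGroup.of b * (FreeGroup.of a)⁻¹
      else FreeGroup.of j)
    (by
      have hba := hab.symm
      ext j
      by_cases h1 : j = a
      · subst h1; simp
      · by_cases h2 : j = b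
        · subst h2; simp [hab, hba, mul_assoc]
        · simp [h1, h2])
    (by
      have hba := hab.symm
      ext j
      by_cases h1 : j = b
      · subst h1; simp
      · by_cases h2 : j = a
        · subst h2; simp [hab, hba, mul_assoc]
        · simp [h1, h2])

theorem artinAut_of {n : ℕ} (a b : Fin n) (hab : a ≠ b) (j : Fin n) :
    artinAut a b hab (FreeGroup.of j) = if j = a then FreeGroup.of b
      else if j = b then (FreeGroup.of b)⁻¹ * FreeGroup.of a * FreeGroup.of b
      else FreeGroup.of j := by
  simp [artinAut]

theorem mulAut_ext {n : ℕ} {f g : MulAut (FreeGroup (Fin n))}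
    (h : ∀ j, f (FreeGroup.of j) = g (FreeGroup.of j)) : f = g := by
  have : f.toMonoidHom = g.toMonoidHom := FreeGroup.ext_hom _ _ h
  exact MulEquiv.ext fun x => DFunLike.congr_fun this x

/-- The Artin homomorphism `a_n : B_n → Aut(F_n)`: the generator `σ i` sends `x_i` to `x_{i+1}`,
`x_{i+1}` to `x_{i+1}⁻¹ x_i x_{i+1}`, and fixes the other `x_j`. -/
def artin (n : ℕ) : BraidGroup n →* MulAut (FreeGroup (Fin n)) :=
  lift (fun i => artinAut (posL i) (posR i) (posL_ne_posR i))
    (by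
      intro i j h
      have h1 : posL i ≠ posL j := by simp [posL, Fin.ext_iff]; omega
      have h2 : posL i ≠ posR j := by simp [posL, posR, Fin.ext_iff]; omega
      have h3 : posR i ≠ posL j := by simp [posL, posR, Fin.ext_iff]; omega
      have h4 : posR i ≠ posR j := by simp [posR, Fin.ext_iff]; omega
      refine mulAut_ext fun k => ?_
      simp only [MulAut.mul_apply, artinAut_of]
      by_cases k1 : k = posL i
      · subst k1; simp [artinAut_of, h1, h2, h3, h4]
      by_cases k2 : k = posR i
      · subst k2; simp [artinAut_of, h1, h2, h3, h4, (posL_ne_posR i).symm]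
      by_cases k3 : k = posL j
      · subst k3; simp [artinAut_of, h1.symm, h2.symm, h3.symm, h4.symm]
      by_cases k4 : k = posR j
      · subst k4
        simp [artinAut_of, h1.symm, h2.symm, h3.symm, h4.symm, (posL_ne_posR j).symm]
      simp [artinAut_of, k1, k2, k3, k4])
    (by
      intro i j h
      have h1 : posL j = posR i := by simp [posL, posR, h]
      have h2 : posL i ≠ posR j := by simp [posL, posR, Fin.ext_iff]; omega
      have h3 := posL_ne_posR i
      have h4 := posL_ne_posR j
      rw [h1] at h4
      refine mulAut_ext fun k => ?_
      simp only [MulAut.mul_apply, artinAut_of, h1]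
      by_cases k1 : k = posL i
      · subst k1; simp [artinAut_of, h2, h3, h2.symm, h4.symm]
      by_cases k2 : k = posR i
      · subst k2; simp [artinAut_of, h2, h3, h2.symm, h3.symm, h4.symm]
      by_cases k3 : k = posR j
      · subst k3; simp [artinAut_of, h2, h3, h2.symm, h3.symm, h4.symm, mul_assoc]
      simp [artinAut_of, k1, k2, k3])

/-- The descending product `σ_{j-1} ⋯ σ_1 σ_0` in `B_{n+1}` (zero-based generators). -/
def desc (n : ℕ) : (j : ℕ) → j ≤ n → BraidGroup (n + 1)
  | 0, _ => 1
  | j + 1, h => σ ⟨j, by omega⟩ * desc n j (by omega)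

/-- The morphism `χ_{n,1} : F_n → B_{n+1}`,
`x_i ↦ (σ_{i-1} ⋯ σ_1)⁻¹ σ_i² (σ_{i-1} ⋯ σ_1)` (one-based indices). -/
def chi (n : ℕ) : FreeGroup (Fin n) →* BraidGroup (n + 1) :=
  FreeGroup.lift fun j =>
    (desc n j.val j.isLt.le)⁻¹ * σ ⟨j.val, by omega⟩ ^ 2 * desc n j.val j.isLt.le

theorem σ_desc_comm {n : ℕ} (j : ℕ) (hj : j ≤ n) (k : Fin (n + 1 - 1)) (hk : j + 1 ≤ k.val) :
    σ k * desc n j hj = desc n j hj * σ k := by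
  induction j with
  | zero => simp [desc]
  | succ j ih =>
    have h1 := σ_comm (n := n + 1) ⟨j, by omega⟩ k (by simp only; omega)
    have h2 := ih (by omega) (by omega)
    rw [desc, ← mul_assoc, ← h1, mul_assoc, h2, mul_assoc]

theorem desc_σ {n : ℕ} (j : ℕ) (hj : j ≤ n) (k l : Fin (n + 1 - 1)) (hl : l.val + 1 = k.val)
    (hk : k.val + 1 ≤ j) :
    desc n j hj * σ k = σ l * desc n j hj := by
  induction j with
  | zero => omega
  | succ j ih =>
    rcases Nat.lt_or_ge k.val j with hlt | hge
    · have h1 := σ_comm (n := n + 1) l ⟨j, by omega⟩ (by simp only; omega)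
      rw [desc, mul_assoc, ih (by omega) (by omega), ← mul_assoc, ← h1, mul_assoc]
    · obtain rfl : j = l.val + 1 := by omega
      have hk' : k = ⟨l.val + 1, by omega⟩ := Fin.ext hl.symm
      have hb := σ_braid (n := n + 1) l k hl
      have hc := σ_desc_comm (n := n) l.val (by omega) k (by omega)
      simp only [desc]
      rw [← hk']
      change σ k * (σ l * desc n l.val _) * σ k = σ l * (σ k * (σ l * desc n l.val _))
      generalize desc n l.val _ = D at *
      calc σ k * (σ l * D) * σ k = σ k * σ l * (D * σ k) := by group
        _ = σ k * σ l * σ k * D := by rw [← hc]; group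
        _ = _ := by rw [← hb]; group

theorem shift_chi_σ (n : ℕ) (i : Fin (n - 1)) (j : Fin n) :
    shift n (σ i) * chi n (FreeGroup.of j) =
      chi n (artin n (σ i) (FreeGroup.of j)) * shift n (σ i) := by
  have hs : shift n (σ i) = σ ⟨i.val + 1, by omega⟩ := lift_σ _ _ _ _
  have ha : artin n (σ i) = artinAut (posL i) (posR i) (posL_ne_posR i) := lift_σ _ _ _ _
  have hchi : ∀ k : Fin n, chi n (FreeGroup.of k) =
      (desc n k.val k.isLt.le)⁻¹ * σ ⟨k.val, by omega⟩ ^ 2 * desc n k.val k.isLt.le :=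
    fun k => FreeGroup.lift_apply_of
  rw [hs, ha, artinAut_of]
  have hR : ∀ h, desc n (posR i).val h =
      σ ⟨i.val, by omega⟩ * desc n i.val (by omega) := fun _ => rfl
  have hb := σ_braid (n := n + 1) ⟨i.val, by omega⟩ ⟨i.val + 1, by omega⟩ rfl
  have hc := σ_desc_comm (n := n) i.val (by omega) ⟨i.val + 1, by omega⟩ le_rfl
  split_ifs with h1 h2
  · subst h1
    rw [hchi, hchi, hR]
    change σ ⟨i.val + 1, _⟩ * ((desc n i.val _)⁻¹ * σ ⟨i.val, _⟩ ^ 2 * desc n i.val _) =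
      (σ ⟨i.val, _⟩ * desc n i.val _)⁻¹ * σ ⟨i.val + 1, _⟩ ^ 2 *
        (σ ⟨i.val, _⟩ * desc n i.val _) * σ ⟨i.val + 1, _⟩
    generalize desc n i.val _ = D at *
    generalize (σ ⟨i.val, _⟩ : BraidGroup (n + 1)) = a at *
    generalize (σ ⟨i.val + 1, _⟩ : BraidGroup (n + 1)) = b at *
    have hc' : b * D⁻¹ = D⁻¹ * b := (Commute.inv_right hc)
    have key : a⁻¹ * b ^ 2 * a * b = b * a ^ 2 := by
      have : b * (b * a * b) = a * (b * a ^ 2) := by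
        calc b * (b * a * b) = (b * a * b) * a := by rw [← hb]; simp only [← mul_assoc, ← hb]
          _ = _ := by rw [← hb, pow_two]; group
      calc a⁻¹ * b ^ 2 * a * b = a⁻¹ * (b * (b * a * b)) := by rw [pow_two]; group
        _ = _ := by rw [this]; group
    calc b * (D⁻¹ * a ^ 2 * D) = (b * D⁻¹) * a ^ 2 * D := by group
      _ = D⁻¹ * (b * a ^ 2) * D := by rw [hc']; group
      _ = D⁻¹ * (a⁻¹ * b ^ 2 * a) * (b * D) := by rw [← key]; group
      _ = _ := by rw [hc]; group
  · subst h2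
    rw [map_mul, map_mul, map_inv, hchi, hchi, hR]
    change σ ⟨i.val + 1, _⟩ * ((σ ⟨i.val, _⟩ * desc n i.val _)⁻¹ * σ ⟨i.val + 1, _⟩ ^ 2 *
        (σ ⟨i.val, _⟩ * desc n i.val _)) =
      ((σ ⟨i.val, _⟩ * desc n i.val _)⁻¹ * σ ⟨i.val + 1, _⟩ ^ 2 *
        (σ ⟨i.val, _⟩ * desc n i.val _))⁻¹ *
      ((desc n i.val _)⁻¹ * σ ⟨i.val, _⟩ ^ 2 * desc n i.val _) *
      ((σ ⟨i.val, _⟩ * desc n i.val _)⁻¹ * σ ⟨i.val + 1, _⟩ ^ 2 *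
        (σ ⟨i.val, _⟩ * desc n i.val _)) * σ ⟨i.val + 1, _⟩
    generalize desc n i.val _ = D at *
    generalize (σ ⟨i.val, _⟩ : BraidGroup (n + 1)) = a at *
    generalize (σ ⟨i.val + 1, _⟩ : BraidGroup (n + 1)) = b at *
    have hc' : b * D⁻¹ = D⁻¹ * b := (Commute.inv_right hc)
    have key : b * a⁻¹ * b ^ 2 * a = a⁻¹ * b⁻¹ ^ 2 * a ^ 2 * b ^ 2 * a * b := by
      have e1 : a * b * a⁻¹ = b⁻¹ * a * b := by
        rw [mul_inv_eq_iff_eq_mul, mul_assoc, mul_assoc, eq_inv_mul_iff_mul_eq, ← mul_assoc,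
          ← mul_assoc, ← hb]
      have e2 : b ^ 2 * (a * b * a⁻¹) * b ^ 2 * a = a ^ 2 * b ^ 2 * a * b := by
        calc b ^ 2 * (a * b * a⁻¹) * b ^ 2 * a = (b * a * b) * (b ^ 2 * a) := by
              rw [e1, pow_two]; group
          _ = (a * b * a) * (b ^ 2 * a) := by rw [hb]
          _ = a * (b * a * b) * (b * a) := by simp only [pow_two, mul_assoc]
          _ = a * (a * b * a) * (b * a) := by rw [← hb]
          _ = a * a * b * (a * b * a) := by group
          _ = _ := by rw [hb, pow_two, pow_two]; group
      calc b * a⁻¹ * b ^ 2 * a = a⁻¹ * b⁻¹ ^ 2 * (b ^ 2 * (a * b * a⁻¹) * b ^ 2 * a) := by group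
        _ = _ := by rw [e2]; group
    calc b * ((a * D)⁻¹ * b ^ 2 * (a * D)) = (b * D⁻¹) * a⁻¹ * b ^ 2 * a * D := by group
      _ = D⁻¹ * (b * a⁻¹ * b ^ 2 * a) * D := by rw [hc']; group
      _ = D⁻¹ * (a⁻¹ * b⁻¹ ^ 2 * a ^ 2 * b ^ 2 * a) * (b * D) := by rw [key]; group
      _ = _ := by rw [hc]; group
  · rw [hchi]
    have h1' : j.val ≠ i.val := fun h => h1 (Fin.ext h)
    have h2' : j.val ≠ i.val + 1 := fun h => h2 (Fin.ext h)
    rcases Nat.lt_or_ge j.val i.val with hlt | hge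
    · have c1 := σ_desc_comm (n := n) j.val j.isLt.le ⟨i.val + 1, by omega⟩
        (by simp only; omega)
      have c2 := σ_comm (n := n + 1) ⟨j.val, by omega⟩ ⟨i.val + 1, by omega⟩
        (by simp only; omega)
      exact ((Commute.inv_right c1).mul_right (Commute.pow_right c2.symm 2)).mul_right c1
    · have c1 := desc_σ (n := n) j.val j.isLt.le ⟨i.val + 1, by omega⟩ ⟨i.val, by omega⟩ rfl
        (by simp only; omega)
      have c2 := σ_comm (n := n + 1) ⟨i.val, by omega⟩ ⟨j.val, by omega⟩
        (by simp only; omega)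
      have c3 := (Commute.pow_right c2 2).eq
      generalize desc n j.val _ = D at *
      generalize (σ ⟨i.val, _⟩ : BraidGroup (n + 1)) = a at *
      generalize (σ ⟨i.val + 1, _⟩ : BraidGroup (n + 1)) = b at *
      generalize (σ ⟨j.val, _⟩ : BraidGroup (n + 1)) = s at *
      have c4 : b * D⁻¹ = D⁻¹ * a := by
        rw [mul_inv_eq_iff_eq_mul, mul_assoc, eq_inv_mul_iff_mul_eq, c1]
      calc b * (D⁻¹ * s ^ 2 * D) = (b * D⁻¹) * s ^ 2 * D := by group
        _ = D⁻¹ * (a * s ^ 2) * D := by rw [c4]; group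
        _ = D⁻¹ * s ^ 2 * (a * D) := by rw [c3]; group
        _ = _ := by rw [← c1]; group

/-- The compatibility of `a_n` and `χ_{n,1}`:
`(id_1 ♮ λ) χ(x) = χ(a_n(λ)(x)) (id_1 ♮ λ)` in `B_{n+1}`. -/
theorem shift_chi (n : ℕ) (g : BraidGroup n) (x : FreeGroup (Fin n)) :
    shift n g * chi n x = chi n (artin n g x) * shift n g := by
  let H : Subgroup (BraidGroup n) :=
    { carrier := {g | ∀ x, shift n g * chi n x = chi n (artin n g x) * shift n g}
      one_mem' := by intro x; simp
      mul_mem' := by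
        intro a b ha hb x
        rw [map_mul, mul_assoc, hb, ← mul_assoc, ha, map_mul, MulAut.mul_apply, mul_assoc]
      inv_mem' := by
        intro a ha x
        have := ha ((artin n a)⁻¹ x)
        rw [MulAut.apply_inv_self] at this
        rw [map_inv, map_inv, inv_mul_eq_iff_eq_mul, ← mul_assoc, this, mul_inv_cancel_right] }
  refine PresentedGroup.generated_by _ H (fun i => ?_) g x
  have hom : ((MulAut.conj (shift n (σ i))).toMonoidHom.comp (chi n)) =
      (chi n).comp (artin n (σ i)).toMonoidHom := by
    refine FreeGroup.ext_hom _ _ fun j => ?_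
    change shift n (σ i) * _ * (shift n (σ i))⁻¹ = _
    rw [shift_chi_σ, mul_inv_cancel_right]
    rfl
  intro x
  exact mul_inv_eq_iff_eq_mul.mp (DFunLike.congr_fun hom x)

/-! ### The Long-Moody construction -/

/-- The augmentation ideal of the integral group ring `ℤ[F_n]`. -/
abbrev augIdeal (n : ℕ) : Ideal (MonoidAlgebra ℤ (FreeGroup (Fin n))) :=
  RingHom.ker (MonoidAlgebra.lift ℤ ℤ (FreeGroup (Fin n)) 1)

/-- Right multiplication by `x ∈ F_n` on the augmentation ideal. -/
def augMul {n : ℕ} (i : augIdeal n) (x : FreeGroup (Fin n)) : augIdeal n :=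
  ⟨i.val * MonoidAlgebra.of ℤ _ x, Ideal.mul_mem_right _ _ i.2⟩

/-- The action on the augmentation ideal of an automorphism of `F_n`, extended linearly. -/
def augAct {n : ℕ} (f : MulAut (FreeGroup (Fin n))) : augIdeal n →ₗ[ℤ] augIdeal n where
  toFun i := ⟨MonoidAlgebra.mapDomainRingHom ℤ f.toMonoidHom i.val, by
    have h : ((MonoidAlgebra.lift ℤ ℤ (FreeGroup (Fin n)) 1).comp
        (MonoidAlgebra.mapDomainAlgHom ℤ ℤ f.toMonoidHom)) =
        MonoidAlgebra.lift ℤ ℤ (FreeGroup (Fin n)) 1 := by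
      ext x; simp
    exact (DFunLike.congr_fun h i.val).trans i.2⟩
  map_add' i j := Subtype.ext (map_add _ _ _)
  map_smul' c i := Subtype.ext (map_zsmul _ c i.val)

theorem augAct_augMul {n : ℕ} (f : MulAut (FreeGroup (Fin n))) (i : augIdeal n)
    (x : FreeGroup (Fin n)) : augAct f (augMul i x) = augMul (augAct f i) (f x) :=
  Subtype.ext ((map_mul (MonoidAlgebra.mapDomainRingHom ℤ f.toMonoidHom) _ _).trans
    (by simp [augAct, augMul]))

theorem augAct_one {n : ℕ} : augAct (1 : MulAut (FreeGroup (Fin n))) = LinearMap.id := by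
  refine LinearMap.ext fun i => Subtype.ext ?_
  have : MonoidAlgebra.mapDomainRingHom ℤ (1 : MulAut (FreeGroup (Fin n))).toMonoidHom =
      RingHom.id _ := by ext x <;> simp
  exact DFunLike.congr_fun this i.val

theorem augAct_mul {n : ℕ} (f g : MulAut (FreeGroup (Fin n))) :
    augAct (f * g) = augAct f ∘ₗ augAct g := by
  refine LinearMap.ext fun i => Subtype.ext ?_
  have : MonoidAlgebra.mapDomainRingHom ℤ (f * g).toMonoidHom =
      (MonoidAlgebra.mapDomainRingHom ℤ f.toMonoidHom).comp
        (MonoidAlgebra.mapDomainRingHom ℤ g.toMonoidHom) := by ext x <;> simp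
  exact DFunLike.congr_fun this i.val

section LM

variable {R V : Type*} [CommRing R] [AddCommGroup V] [Module R V]

/-- The `R`-submodule of `V ⊗_ℤ I` that is divided out to form `I ⊗_{F_n} V`: it is spanned by
the elements that identify `(i x) ⊗ v` with `i ⊗ (x v)` for `x ∈ F_n`, where `x` acts on `V`
through `χ_{n,1}`. The factor `V` is written on the left because Mathlib lets `R` act on the
left factor of a tensor product over `ℤ`. -/
def lmRel (n : ℕ) (ρ : Representation R (BraidGroup (n + 1)) V) :
    Submodule R (V ⊗[ℤ] augIdeal n) :=
  Submodule.span R {w | ∃ (v : V) (i : augIdeal n) (x : FreeGroup (Fin n)),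
    w = v ⊗ₜ[ℤ] augMul i x - ρ (chi n x) v ⊗ₜ[ℤ] i}

/-- The module `I_{F_n} ⊗_{F_n} V` of the Long-Moody construction. -/
abbrev LMModule (n : ℕ) (ρ : Representation R (BraidGroup (n + 1)) V) : Type _ :=
  (V ⊗[ℤ] augIdeal n) ⧸ lmRel n ρ

/-- The operator `i ⊗ v ↦ a_n(g)(i) ⊗ ρ(id_1 ♮ g)(v)` before passing to the quotient. -/
def lmPre (n : ℕ) (ρ : Representation R (BraidGroup (n + 1)) V) (g : BraidGroup n) :
    V ⊗[ℤ] augIdeal n →ₗ[R] V ⊗[ℤ] augIdeal n :=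
  TensorProduct.AlgebraTensorModule.map (ρ (shift n g)) (augAct (artin n g))

theorem lmPre_mem (n : ℕ) (ρ : Representation R (BraidGroup (n + 1)) V) (g : BraidGroup n) :
    lmRel n ρ ≤ (lmRel n ρ).comap (lmPre n ρ g) := by
  refine Submodule.span_le.mpr ?_
  rintro _ ⟨v, i, x, rfl⟩
  refine Submodule.subset_span ⟨ρ (shift n g) v, augAct (artin n g) i, artin n g x, ?_⟩
  have h : ρ (shift n g) (ρ (chi n x) v) = ρ (chi n (artin n g x)) (ρ (shift n g) v) := by
    rw [← Module.End.mul_apply, ← map_mul, shift_chi, map_mul, Module.End.mul_apply]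
  simp [lmPre, augAct_augMul, h]

/-- The Long-Moody construction `LM(ρ) : B_n → Aut(I_{F_n} ⊗_{F_n} V)`,
`g (i ⊗ v) = a_n(g)(i) ⊗ ρ(id_1 ♮ g)(v)`. -/
def LM (n : ℕ) (ρ : Representation R (BraidGroup (n + 1)) V) :
    Representation R (BraidGroup n) (LMModule n ρ) where
  toFun g := (lmRel n ρ).mapQ (lmRel n ρ) (lmPre n ρ g) (lmPre_mem n ρ g)
  map_one' := by
    have : lmPre n ρ 1 = LinearMap.id := by
      simp only [lmPre, map_one, augAct_one]
      exact TensorProduct.AlgebraTensorModule.map_id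
    refine LinearMap.ext fun w => ?_
    obtain ⟨w, rfl⟩ := Submodule.Quotient.mk_surjective _ w
    simp [this]
  map_mul' g h := by
    have : lmPre n ρ (g * h) = lmPre n ρ g ∘ₗ lmPre n ρ h := by
      simp only [lmPre, map_mul, augAct_mul]
      exact TensorProduct.AlgebraTensorModule.map_comp _ _ _ _
    refine LinearMap.ext fun w => ?_
    obtain ⟨w, rfl⟩ := Submodule.Quotient.mk_surjective _ w
    simp [this]

/-- The twisted construction `LM_q(ρ) = R_{q⁻¹} ⊗ LM(R_q ⊗ ρ)`, where `R_r` is the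
one-dimensional representation in which every Artin generator acts by `r`. -/
def LMq (n : ℕ) (q : Rˣ) (ρ : Representation R (BraidGroup (n + 1)) V) :
    Representation R (BraidGroup n) (R ⊗[R] LMModule n ((oneDim (n + 1) q).tprod ρ)) :=
  (oneDim n q⁻¹).tprod (LM n ((oneDim (n + 1) q).tprod ρ))

/-- The module underlying `LM_q(TYM_{n+1})`. -/
abbrev LMqTYMModule (t q : Rˣ) (n : ℕ) : Type _ :=
  R ⊗[R] LMModule n ((oneDim (n + 1) q).tprod (matrixRep (tym (n + 1) t)))

/-- The representation `LM_q(TYM_{n+1})` of `B_n`. -/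
def LMqTYM (t q : Rˣ) (n : ℕ) : Representation R (BraidGroup n) (LMqTYMModule t q n) :=
  LMq n q (matrixRep (tym (n + 1) t))

/-- The translation `τ_1 LM_q(TYM_{n+1})`: the next member `LM_q(TYM_{n+2})` of the family,
which is a representation of `B_{n+1}`, restricted to `B_n` along `id_1 ♮ -`. -/
def tauLMqTYM (t q : Rˣ) (n : ℕ) :
    Representation R (BraidGroup n) (LMqTYMModule t q (n + 1)) :=
  (LMqTYM t q (n + 1)).comp (shift n)

end LM

/-! ### The ring `ℤ[t^{±1}, q^{±1}]` -/

/-- The ring `ℤ[t^{±1}, q^{±1}]`, built as `ℤ[t^{±1}][q^{±1}]`. -/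
abbrev LaurentTQ : Type := ℤ[T;T⁻¹][T;T⁻¹]

/-- The variable of a Laurent polynomial ring, as a unit. -/
def laurentVar (A : Type*) [CommRing A] : (A[T;T⁻¹])ˣ where
  val := LaurentPolynomial.T 1
  inv := LaurentPolynomial.T (-1)
  val_inv := by rw [← LaurentPolynomial.T_add]; simp
  inv_val := by rw [← LaurentPolynomial.T_add]; simp

/-- The unit `t`. -/
def tVar : LaurentTQˣ :=
  Units.map (LaurentPolynomial.C : ℤ[T;T⁻¹] →+* LaurentTQ) (laurentVar ℤ)

/-- The unit `q`. -/
def qVar : LaurentTQˣ := laurentVar ℤ[T;T⁻¹]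

end LongMoody

end

/-!
All indices count from zero. Over the free group `F_{n+1}` on `x_0, …, x_n`, the augmentation ideal is free on the elements
`x_j - 1`, so `LM_q(TYM_{n+2})` has a basis `(x_j - 1) ⊗ e_k`. Every `x_j` acts on
`V = R^{n+2}` by a diagonal matrix, and, since the braid group has been shifted twice by the time
it acts on `V`, the generators of `B_n` fix the vector `e_1` up to the twist. Hence the
coordinate `e_1` splits off, and on the vectors `(x_j - 1) ⊗ e_1` with `j ≥ 1`, where `x_j` acts
on `e_1` by `q²`, the Artin action gives `b_j ↦ b_{j+1}` and `b_{j+1} ↦ q² b_j + (1 - q²) b_{j+1}`, where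
`b_j = (x_j - 1) ⊗ e_1`, which is `Bur_{n,q²}`. The required map is the projection to this summand.

The projection is written down without choosing a basis of the augmentation ideal, as
`v ⊗ i ↦ v_1 • D(i)`, where `D` is the linear extension of the crossed homomorphism
`D(xy) = c(y) D(x) + D(y)` with `D(x_0) = 0`, `D(x_{j+1}) = e_j`, and `c` is the character
through which the free group acts on `e_1`. The crossed homomorphism is encoded as a homomorphism
`burauAffine` to the affine automorphisms `(m, s) ↦ (m + s D(x), c(x) s)` of `R^n × R`
(lemmas `coordOne_twist_chi`, `foxMap_augMul`); its equivariance is the conjugation identity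
`burau_semiconj_affine`. The inclusion of kernels is a formal consequence of having an equivariant
surjection.
-/

open scoped TensorProduct

noncomputable section

namespace LongMoody

open BraidGroup

/-! ### Representations of braid groups on generators -/

section General

variable {R V W : Type*} [CommRing R] [AddCommMonoid V] [Module R V] [AddCommMonoid W]
  [Module R W]

theorem BraidGroup.comp_rep_of_generators {n : ℕ} (ρ : Representation R (BraidGroup n) V)
    (ρ' : Representation R (BraidGroup n) W) (f : V →ₗ[R] W)
    (h : ∀ i v, f (ρ (σ i) v) = ρ' (σ i) (f v)) (g : BraidGroup n) (v : V) :
    f (ρ g v) = ρ' g (f v) := by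
  let H : Subgroup (BraidGroup n) :=
    { carrier := {g | ∀ v, f (ρ g v) = ρ' g (f v)}
      one_mem' := by intro v; simp
      mul_mem' := by
        intro a b ha hb v
        simp only [map_mul, Module.End.mul_apply]
        rw [ha, hb]
      inv_mem' := by
        intro a ha v
        have h1 := ha (ρ a⁻¹ v)
        rw [Representation.self_inv_apply] at h1
        rw [h1, Representation.inv_self_apply] }
  exact PresentedGroup.generated_by _ H h g v

theorem ker_le_of_surjective_intertwining {G : Type*} [Group G] {ρ : Representation R G V}
    {ρ' : Representation R G W} (π : ρ.IntertwiningMap ρ') (hπ : Function.Surjective π) :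
    MonoidHom.ker ρ ≤ MonoidHom.ker ρ' := by
  intro g hg
  rw [MonoidHom.mem_ker] at hg ⊢
  refine LinearMap.ext fun w => ?_
  obtain ⟨v, rfl⟩ := hπ w
  have h := LinearMap.congr_fun (π.isIntertwining' g) v
  rw [hg] at h
  exact h.symm

end General

section Matrices

variable {R : Type*} [CommRing R]

theorem matrixRep_apply {G : Type*} [Group G] {m : ℕ} (ρ : G →* GL (Fin m) R) (g : G)
    (v : Fin m → R) : matrixRep ρ g v = (ρ g).val.mulVec v := rfl

theorem matrixRep_tym_σ {n : ℕ} (u : Rˣ) (i : Fin (n - 1)) (v : Fin n → R) (r : Fin n) :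
    matrixRep (tym n u) (σ i) v r =
      if r = posL i then v (posR i) else if r = posR i then u * v (posL i) else v r := by
  rw [matrixRep_apply, tym, lift_σ, blockGL_val, block_mulVec (posL_ne_posR i)]
  simp [tymBlock]

theorem matrixRep_burau_σ {n : ℕ} (u : Rˣ) (i : Fin (n - 1)) (v : Fin n → R) (r : Fin n) :
    matrixRep (burau n u) (σ i) v r =
      if r = posL i then u * v (posR i)
      else if r = posR i then v (posL i) + (1 - u) * v (posR i) else v r := by
  rw [matrixRep_apply, burau, lift_σ, blockGL_val, block_mulVec (posL_ne_posR i)]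
  simp [burauBlock]

theorem oneDim_apply (n : ℕ) (r : Rˣ) (g : BraidGroup n) (s : R) :
    oneDim n r g s = (character n r g : R) * s := rfl

theorem oneDim_σ (n : ℕ) (r : Rˣ) (i : Fin (n - 1)) (s : R) :
    oneDim n r (σ i) s = r * s := by
  rw [oneDim_apply, character, lift_σ]

theorem shift_σ (n : ℕ) (i : Fin (n - 1)) : shift n (σ i) = σ ⟨i.val + 1, by omega⟩ :=
  lift_σ _ _ _ _

theorem artin_σ (n : ℕ) (i : Fin (n - 1)) :
    artin n (σ i) = artinAut (posL i) (posR i) (posL_ne_posR i) :=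
  lift_σ _ _ _ _

/-! ### The free group acting on one coordinate of the Tong-Yang-Ma representation -/

/-- The coordinate `1` becomes the coordinate `0` under the positive braid `σ_j ⋯ σ_0`. -/
theorem tym_desc_zero (n : ℕ) (u : Rˣ) (j : ℕ) (hj : j + 1 ≤ n + 1) (v : Fin (n + 2) → R) :
    matrixRep (tym (n + 2) u) (desc (n + 1) (j + 1) hj) v 0 = v 1 := by
  induction j with
  | zero =>
    simp only [desc, mul_one]
    rw [matrixRep_tym_σ]
    exact if_pos rfl
  | succ j ih =>
    rw [desc, map_mul, Module.End.mul_apply, matrixRep_tym_σ]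
    simp [posL, posR, Fin.ext_iff, ih (by omega)]

theorem tym_chi_of_one (n : ℕ) (u : Rˣ) (j : Fin (n + 1)) (v : Fin (n + 2) → R) :
    matrixRep (tym (n + 2) u) (chi (n + 1) (FreeGroup.of j)) v 1 =
      (if j = 0 then (u : R) else 1) * v 1 := by
  obtain ⟨j, hj⟩ := j
  rw [chi, FreeGroup.lift_apply_of]
  cases j with
  | zero =>
    simp only [desc, inv_one, one_mul, mul_one, pow_two, map_mul, Module.End.mul_apply]
    simp only [matrixRep_tym_σ]
    simp [posL, posR]
  | succ j =>
    -- Coordinate `1` is read off as coordinate `0` after `desc`, where `σ_{j+1}` acts trivially.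
    rw [← tym_desc_zero n u j (by omega) (matrixRep (tym (n + 2) u) _ v), ← Module.End.mul_apply, ← map_mul, mul_assoc,
      mul_inv_cancel_left, map_mul, Module.End.mul_apply, pow_two, map_mul, Module.End.mul_apply]
    simp only [matrixRep_tym_σ]
    simp [posL, posR, Fin.ext_iff, tym_desc_zero n u j (by omega)]

/-- The character through which `F_{n+1}` acts on the coordinate `1` of `R_q ⊗ TYM_{n+2}`:
it sends `x_0` to `q² t` and the other generators to `q²`. -/
def chiChar (n : ℕ) (t q : Rˣ) : FreeGroup (Fin (n + 1)) →* Rˣ :=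
  FreeGroup.lift fun j => if j = 0 then q ^ 2 * t else q ^ 2

/-- The coordinate `1` on `R_q ⊗ TYM_{n+2}`, with `R ⊗ R^{n+2}` identified with `R^{n+2}`. -/
def coordOne (R : Type*) [CommRing R] (n : ℕ) : R ⊗[R] (Fin (n + 2) → R) →ₗ[R] R :=
  (LinearMap.proj 1).comp (TensorProduct.lid R (Fin (n + 2) → R)).toLinearMap

theorem coordOne_tmul (n : ℕ) (r : R) (v : Fin (n + 2) → R) :
    coordOne R n (r ⊗ₜ v) = r * v 1 := by
  simp [coordOne]

theorem character_chi_of (n : ℕ) (q : Rˣ) (j : Fin n) :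
    character (n + 1) q (chi n (FreeGroup.of j)) = q ^ 2 := by
  rw [chi, FreeGroup.lift_apply_of, map_mul, map_mul, map_inv, mul_right_comm, inv_mul_cancel,
    one_mul, map_pow, character, lift_σ]

theorem coordOne_twist_chi (n : ℕ) (t q : Rˣ) (x : FreeGroup (Fin (n + 1)))
    (w : R ⊗[R] (Fin (n + 2) → R)) :
    coordOne R n (((oneDim (n + 2) q).tprod (matrixRep (tym (n + 2) t))) (chi (n + 1) x) w) =
      chiChar n t q x * coordOne R n w := by
  set ρ := (oneDim (n + 2) q).tprod (matrixRep (tym (n + 2) t)) with hρ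
  induction x using FreeGroup.induction_on generalizing w with
  | C1 => simp
  | of j =>
    induction w with
    | zero => simp
    | add a b ha hb => rw [map_add, map_add, ha, hb, map_add, mul_add]
    | tmul r v =>
      rw [hρ, Representation.tprod_apply, TensorProduct.map_tmul, coordOne_tmul, coordOne_tmul,
        tym_chi_of_one, oneDim_apply, character_chi_of, chiChar, FreeGroup.lift_apply_of]
      split_ifs <;> push_cast <;> ring
  | inv_of j h =>
    have h1 := h (ρ (chi (n + 1) (FreeGroup.of j)⁻¹) w)
    rw [map_inv, Representation.self_inv_apply] at h1
    rw [map_inv (chi (n + 1)), h1, map_inv (chiChar n t q), Units.inv_mul_cancel_left]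
  | mul x y hx hy =>
    rw [map_mul, map_mul, Module.End.mul_apply, hx, hy, map_mul, Units.val_mul, mul_assoc]

end Matrices

/-! ### The crossed homomorphism on the free group -/

section Fox

variable {R : Type*} [CommRing R]

/-- The automorphism `(m, s) ↦ (m + s d, c s)` of `M × R`. -/
def affineUnit {M : Type*} [AddCommGroup M] [Module R M] (d : M) (c : Rˣ) :
    (Module.End R (M × R))ˣ where
  val := (LinearMap.fst R M R + (LinearMap.snd R M R).smulRight d).prod
    ((c : R) • LinearMap.snd R M R)
  inv := (LinearMap.fst R M R + (LinearMap.snd R M R).smulRight (-((↑c⁻¹ : R) • d))).prod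
    ((↑c⁻¹ : R) • LinearMap.snd R M R)
  val_inv := by
    refine LinearMap.ext fun ⟨m, s⟩ => ?_
    simp [smul_smul, mul_comm s]
  inv_val := by
    refine LinearMap.ext fun ⟨m, s⟩ => Prod.ext ?_ ?_
    · simp [smul_smul, mul_right_comm (c : R) s]
    · simp

theorem affineUnit_apply {M : Type*} [AddCommGroup M] [Module R M] (d : M) (c : Rˣ)
    (m : M) (s : R) : (affineUnit d c).val (m, s) = (m + s • d, c * s) := rfl

/-- The homomorphism `x ↦ ((m, s) ↦ (m + s D(x), c(x) s))` that encodes the crossed homomorphism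
`D : F_{n+1} → R^n` with `D(x_0) = 0` and `D(x_{j+1}) = e_j`, where `c = chiChar n t q`. -/
def burauAffine (n : ℕ) (t q : Rˣ) :
    FreeGroup (Fin (n + 1)) →* (Module.End R ((Fin n → R) × R))ˣ :=
  FreeGroup.lift fun j =>
    affineUnit (Fin.cases 0 (fun k => Pi.single k 1) j) (if j = 0 then q ^ 2 * t else q ^ 2)

theorem burauAffine_of_zero (n : ℕ) (t q : Rˣ) :
    burauAffine n t q (FreeGroup.of 0) = affineUnit 0 (q ^ 2 * t) := by
  rw [burauAffine, FreeGroup.lift_apply_of]; simp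

theorem burauAffine_of_succ (n : ℕ) (t q : Rˣ) (k : Fin n) :
    burauAffine n t q (FreeGroup.of k.succ) = affineUnit (Pi.single k 1) (q ^ 2) := by
  rw [burauAffine, FreeGroup.lift_apply_of]; simp

theorem burauAffine_apply_fst (n : ℕ) (t q : Rˣ) (x : FreeGroup (Fin (n + 1)))
    (m : Fin n → R) : (burauAffine n t q x).val (m, 0) = (m, 0) := by
  induction x using FreeGroup.induction_on generalizing m with
  | C1 => simp
  | of j => simp [burauAffine, affineUnit_apply]
  | inv_of j h =>
    have h1 := congrArg (burauAffine n t q (FreeGroup.of j)⁻¹).val (h m)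
    rw [← Module.End.mul_apply, ← Units.val_mul, ← map_mul, inv_mul_cancel, map_one] at h1
    exact h1.symm
  | mul x y hx hy => rw [map_mul, Units.val_mul, Module.End.mul_apply, hy, hx]

theorem burauAffine_apply_snd (n : ℕ) (t q : Rˣ) (x : FreeGroup (Fin (n + 1)))
    (w : (Fin n → R) × R) : ((burauAffine n t q x).val w).2 = chiChar n t q x * w.2 := by
  induction x using FreeGroup.induction_on generalizing w with
  | C1 => simp
  | of j =>
    obtain ⟨m, s⟩ := w
    simp only [burauAffine, chiChar, FreeGroup.lift_apply_of, affineUnit_apply]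
  | inv_of j h =>
    have h1 := h ((burauAffine n t q (FreeGroup.of j)⁻¹).val w)
    rw [← Module.End.mul_apply, ← Units.val_mul, ← map_mul, mul_inv_cancel, map_one] at h1
    rw [map_inv (chiChar n t q), Units.eq_inv_mul_iff_mul_eq]
    exact h1.symm
  | mul x y hx hy =>
    rw [map_mul, Units.val_mul, Module.End.mul_apply, hx, hy, map_mul, Units.val_mul, mul_assoc]

/-- The linear extension of `burauAffine` to the group ring. -/
def burauAffineAlg (n : ℕ) (t q : Rˣ) :
    MonoidAlgebra ℤ (FreeGroup (Fin (n + 1))) →ₐ[ℤ] Module.End R ((Fin n → R) × R) :=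
  MonoidAlgebra.lift ℤ _ _ ((Units.coeHom _).comp (burauAffine n t q))

theorem burauAffineAlg_of (n : ℕ) (t q : Rˣ) (x : FreeGroup (Fin (n + 1))) :
    burauAffineAlg n t q (MonoidAlgebra.of ℤ _ x) = (burauAffine n t q x).val := by
  simp [burauAffineAlg]

theorem burauAffineAlg_apply_fst (n : ℕ) (t q : Rˣ)
    (z : MonoidAlgebra ℤ (FreeGroup (Fin (n + 1)))) (m : Fin n → R) :
    burauAffineAlg n t q z (m, 0) = (MonoidAlgebra.lift ℤ ℤ (FreeGroup (Fin (n + 1))) 1 z) •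
      ((m, 0) : (Fin n → R) × R) := by
  induction z using MonoidAlgebra.induction_on with
  | of x => rw [burauAffineAlg_of, burauAffine_apply_fst, MonoidAlgebra.lift_of]; simp
  | add a b ha hb => rw [map_add, LinearMap.add_apply, ha, hb, map_add, add_smul]
  | smul r z h => rw [map_smul, LinearMap.smul_apply, h, map_smul, smul_assoc]

/-- The restriction to the augmentation ideal of the linear extension of the crossed
homomorphism `D`. -/
def foxMap (n : ℕ) (t q : Rˣ) : augIdeal (n + 1) →ₗ[ℤ] (Fin n → R) where
  toFun i := (burauAffineAlg n t q i.val (0, 1)).1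
  map_add' i j := by simp
  map_smul' c i := by simp

theorem foxMap_apply (n : ℕ) (t q : Rˣ) (i : augIdeal (n + 1)) :
    foxMap n t q i = (burauAffineAlg n t q i.val ((0, 1) : (Fin n → R) × R)).1 := rfl

theorem foxMap_augMul (n : ℕ) (t q : Rˣ) (i : augIdeal (n + 1)) (x : FreeGroup (Fin (n + 1))) :
    foxMap n t q (augMul i x) = (chiChar n t q x : R) • foxMap n t q i := by
  set w := (burauAffine n t q x).val ((0, 1) : (Fin n → R) × R) with hw
  have h2 : w.2 = chiChar n t q x := by rw [hw, burauAffine_apply_snd, mul_one]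
  have hsplit : w = (w.1, 0) + (chiChar n t q x : R) • ((0, 1) : (Fin n → R) × R) := by
    ext <;> simp [h2]
  have hi : MonoidAlgebra.lift ℤ ℤ (FreeGroup (Fin (n + 1))) 1 i.val = 0 := i.2
  rw [foxMap_apply, foxMap_apply, augMul, map_mul, Module.End.mul_apply, burauAffineAlg_of, ← hw,
    hsplit, map_add, map_smul, burauAffineAlg_apply_fst, hi]
  simp

/-! ### Equivariance of the crossed homomorphism -/

theorem matrixRep_burau_σ_single_posL {n : ℕ} (u : Rˣ) (i : Fin (n - 1)) :
    matrixRep (burau n u) (σ i) (Pi.single (posL i) 1) = Pi.single (posR i) 1 := by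
  have h := posL_ne_posR i
  ext r
  rw [matrixRep_burau_σ]
  by_cases h1 : r = posL i
  · subst h1; simp [h.symm, h]
  · by_cases h2 : r = posR i
    · subst h2; simp [h.symm]
    · simp [h1, h2]

theorem matrixRep_burau_σ_single_posR {n : ℕ} (u : Rˣ) (i : Fin (n - 1)) :
    matrixRep (burau n u) (σ i) (Pi.single (posR i) 1) =
      (u : R) • Pi.single (posL i) 1 + (1 - (u : R)) • Pi.single (posR i) 1 := by
  have h := posL_ne_posR i
  ext r
  rw [matrixRep_burau_σ]
  by_cases h1 : r = posL i
  · subst h1; simp [h]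
  · by_cases h2 : r = posR i
    · subst h2; simp [h.symm, h]
    · simp [h1, h2]

theorem matrixRep_burau_σ_single_of_ne {n : ℕ} (u : Rˣ) (i : Fin (n - 1)) (k : Fin n)
    (hL : k ≠ posL i) (hR : k ≠ posR i) :
    matrixRep (burau n u) (σ i) (Pi.single k 1) = Pi.single k (1 : R) := by
  ext r
  rw [matrixRep_burau_σ]
  by_cases h1 : r = posL i
  · subst h1; simp [hL.symm, hR.symm]
  · by_cases h2 : r = posR i
    · subst h2; simp [hL.symm, hR.symm]
    · simp [h1, h2]

/-- The crossed homomorphism intertwines the Artin action of the shifted generator with the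
Burau matrix: the two affine actions of the free group are conjugate by `Bur(σ_i) × id`. -/
theorem burau_semiconj_affine (n : ℕ) (t q : Rˣ) (i : Fin (n - 1))
    (x : FreeGroup (Fin (n + 1))) :
    SemiconjBy ((matrixRep (burau n (q ^ 2)) (σ i)).prodMap (LinearMap.id : R →ₗ[R] R))
      (burauAffine n t q x).val
      (burauAffine n t q (artin (n + 1) (shift n (σ i)) x)).val := by
  have hsucc : artin (n + 1) (shift n (σ i)) = artinAut (posL i).succ (posR i).succ
      (fun h => posL_ne_posR i (Fin.succ_injective _ h)) := by
    rw [shift_σ, artin_σ]; rfl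
  have hLR := posL_ne_posR i
  rw [hsucc]
  set L := (matrixRep (burau n (q ^ 2)) (σ i)).prodMap (LinearMap.id : R →ₗ[R] R) with hL
  have hLapp : ∀ m s, L (m, s) = (matrixRep (burau n (q ^ 2)) (σ i) m, s) := fun m s => rfl
  induction x using FreeGroup.induction_on with
  | C1 => simp
  | of j =>
    rw [artinAut_of]
    cases j using Fin.cases with
    | zero =>
      rw [if_neg (Fin.succ_ne_zero _).symm, if_neg (Fin.succ_ne_zero _).symm,
        burauAffine_of_zero]
      refine LinearMap.ext fun ⟨m, s⟩ => ?_
      simp [hLapp, affineUnit_apply]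
    | succ k =>
      simp only [Fin.succ_inj]
      by_cases h1 : k = posL i
      · subst h1
        rw [if_pos rfl, burauAffine_of_succ, burauAffine_of_succ]
        refine LinearMap.ext fun ⟨m, s⟩ => ?_
        simp only [Module.End.mul_apply, hLapp, affineUnit_apply, map_add, map_smul,
          matrixRep_burau_σ_single_posL]
      by_cases h2 : k = posR i
      · subst h2
        -- Multiplied by the image of `x_{i+2}` (that is, `(posR i).succ`) on the left, both sides are free of inverses.
        rw [if_neg hLR.symm, if_pos rfl, SemiconjBy,
          ← Units.mul_right_inj (burauAffine n t q (FreeGroup.of (posR i).succ)), ← mul_assoc,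
          ← mul_assoc, ← Units.val_mul, ← map_mul, ← mul_assoc, mul_inv_cancel_left, map_mul,
          burauAffine_of_succ, burauAffine_of_succ]
        refine LinearMap.ext fun ⟨m, s⟩ => ?_
        simp only [Units.val_mul, Module.End.mul_apply, hLapp, affineUnit_apply, map_add, map_smul,
          matrixRep_burau_σ_single_posR]
        refine Prod.ext ?_ rfl
        push_cast
        module
      · rw [if_neg h1, if_neg h2, burauAffine_of_succ]
        refine LinearMap.ext fun ⟨m, s⟩ => ?_
        simp only [Module.End.mul_apply, hLapp, affineUnit_apply, map_add, map_smul,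
          matrixRep_burau_σ_single_of_ne _ _ _ h1 h2]
  | inv_of j h =>
    rw [map_inv, map_inv, map_inv]
    exact SemiconjBy.units_inv_right h
  | mul x y hx hy =>
    simp only [map_mul, Units.val_mul]
    exact hx.mul_right hy

theorem burauAffineAlg_augAct (n : ℕ) (t q : Rˣ) (i : Fin (n - 1))
    (z : MonoidAlgebra ℤ (FreeGroup (Fin (n + 1)))) :
    SemiconjBy ((matrixRep (burau n (q ^ 2)) (σ i)).prodMap (LinearMap.id : R →ₗ[R] R))
      (burauAffineAlg n t q z)
      (burauAffineAlg n t q (MonoidAlgebra.mapDomainRingHom ℤ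
        (artin (n + 1) (shift n (σ i))).toMonoidHom z)) := by
  induction z using MonoidAlgebra.induction_on with
  | of x =>
    have h : MonoidAlgebra.mapDomainRingHom ℤ (artin (n + 1) (shift n (σ i))).toMonoidHom
        (MonoidAlgebra.of ℤ _ x) = MonoidAlgebra.of ℤ _ (artin (n + 1) (shift n (σ i)) x) := by
      simp
    rw [h, burauAffineAlg_of, burauAffineAlg_of]
    exact burau_semiconj_affine n t q i x
  | add a b ha hb =>
    simp only [map_add]
    exact ha.add_right hb
  | smul r z h =>
    rw [map_zsmul, map_zsmul, map_zsmul]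
    unfold SemiconjBy at h ⊢
    rw [mul_smul_comm, h, smul_mul_assoc]

theorem foxMap_augAct (n : ℕ) (t q : Rˣ) (i : Fin (n - 1)) (z : augIdeal (n + 1)) :
    foxMap n t q (augAct (artin (n + 1) (shift n (σ i))) z) =
      matrixRep (burau n (q ^ 2)) (σ i) (foxMap n t q z) := by
  have h := LinearMap.congr_fun (burauAffineAlg_augAct (R := R) n t q i z.val) (0, 1)
  have h' := congrArg Prod.fst h
  simp only [Module.End.mul_apply, LinearMap.prodMap_apply, map_zero, LinearMap.id_apply] at h'
  exact h'.symm

end Fox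

/-! ### The projection to the Burau representation -/

section Projection

variable {R : Type*} [CommRing R]

/-- The map `v ⊗ i ↦ v_1 • D(i)` on the Long-Moody module. -/
def lmToBurau (n : ℕ) (t q : Rˣ) :
    LMModule (n + 1) ((oneDim (n + 2) q).tprod (matrixRep (tym (n + 2) t))) →ₗ[R]
      (Fin n → R) :=
  (lmRel _ _).liftQ
    (TensorProduct.AlgebraTensorModule.lift
      ((LinearMap.toSpanSingleton R (augIdeal (n + 1) →ₗ[ℤ] (Fin n → R)) (foxMap n t q)).comp
        (coordOne R n))) (by
    refine Submodule.span_le.mpr ?_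
    rintro _ ⟨v, i, x, rfl⟩
    simp only [SetLike.mem_coe, LinearMap.mem_ker, map_sub,
      TensorProduct.AlgebraTensorModule.lift_tmul, LinearMap.comp_apply,
      LinearMap.toSpanSingleton_apply, LinearMap.smul_apply]
    rw [foxMap_augMul, coordOne_twist_chi, smul_smul, mul_comm, sub_self])

theorem lmToBurau_mk (n : ℕ) (t q : Rˣ) (v : R ⊗[R] (Fin (n + 2) → R)) (i : augIdeal (n + 1)) :
    lmToBurau n t q (Submodule.Quotient.mk (v ⊗ₜ i)) = coordOne R n v • foxMap n t q i := rfl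

/-- The coordinate `1` is fixed by the doubly shifted braid generators, up to the twist. -/
theorem coordOne_twist_shift (n : ℕ) (t q : Rˣ) (i : Fin (n - 1))
    (w : R ⊗[R] (Fin (n + 2) → R)) :
    coordOne R n (((oneDim (n + 2) q).tprod (matrixRep (tym (n + 2) t)))
      (shift (n + 1) (shift n (σ i))) w) = q * coordOne R n w := by
  rw [shift_σ, shift_σ, Representation.tprod_apply]
  induction w with
  | zero => simp
  | add a b ha hb => rw [map_add, map_add, ha, hb, map_add, mul_add]
  | tmul r v =>
    rw [TensorProduct.map_tmul, coordOne_tmul, coordOne_tmul, oneDim_σ, matrixRep_tym_σ]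
    simp [posL, posR, Fin.ext_iff, mul_assoc]

theorem lmToBurau_LM (n : ℕ) (t q : Rˣ) (i : Fin (n - 1))
    (w : LMModule (n + 1) ((oneDim (n + 2) q).tprod (matrixRep (tym (n + 2) t)))) :
    lmToBurau n t q (LM (n + 1) _ (shift n (σ i)) w) =
      (q : R) • matrixRep (burau n (q ^ 2)) (σ i) (lmToBurau n t q w) := by
  obtain ⟨w, rfl⟩ := Submodule.Quotient.mk_surjective _ w
  induction w with
  | zero => simp
  | add a b ha hb =>
    rw [Submodule.Quotient.mk_add, map_add, map_add, ha, hb, map_add, map_add, smul_add]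
  | tmul v z =>
    have h : LM (n + 1) ((oneDim (n + 2) q).tprod (matrixRep (tym (n + 2) t)))
        (shift n (σ i)) (Submodule.Quotient.mk (v ⊗ₜ z)) =
        Submodule.Quotient.mk
          ((((oneDim (n + 2) q).tprod (matrixRep (tym (n + 2) t)))
            (shift (n + 1) (shift n (σ i))) v) ⊗ₜ
          augAct (artin (n + 1) (shift n (σ i))) z) := rfl
    rw [h, lmToBurau_mk, lmToBurau_mk, coordOne_twist_shift, foxMap_augAct, map_smul, smul_smul]

/-- The map `r ⊗ w ↦ r • lmToBurau w` on the module of `τ_1 LM_q(TYM_{n+1})`. -/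
def tauToBurau (n : ℕ) (t q : Rˣ) : LMqTYMModule t q (n + 1) →ₗ[R] (Fin n → R) :=
  (lmToBurau n t q).comp (TensorProduct.lid R _).toLinearMap

theorem tauToBurau_tmul (n : ℕ) (t q : Rˣ) (r : R)
    (w : LMModule (n + 1) ((oneDim (n + 2) q).tprod (matrixRep (tym (n + 2) t)))) :
    tauToBurau n t q (r ⊗ₜ w) = r • lmToBurau n t q w := by
  simp [tauToBurau]

theorem tauToBurau_σ (n : ℕ) (t q : Rˣ) (i : Fin (n - 1)) (w : LMqTYMModule t q (n + 1)) :
    tauToBurau n t q (tauLMqTYM t q n (σ i) w) =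
      matrixRep (burau n (q ^ 2)) (σ i) (tauToBurau n t q w) := by
  induction w using TensorProduct.induction_on with
  | zero => simp
  | add a b ha hb => rw [map_add, map_add, ha, hb, map_add, map_add]
  | tmul r w =>
    have h : tauLMqTYM t q n (σ i) (r ⊗ₜ w) =
        (oneDim (n + 1) q⁻¹ (shift n (σ i)) r) ⊗ₜ[R] (LM (n + 1) _ (shift n (σ i)) w) := rfl
    rw [h, tauToBurau_tmul, tauToBurau_tmul, lmToBurau_LM, shift_σ, oneDim_σ, map_smul, smul_smul,
      mul_right_comm, Units.inv_mul, one_mul]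

theorem tauToBurau_surjective (n : ℕ) (t q : Rˣ) : Function.Surjective (tauToBurau n t q) := by
  rw [← LinearMap.range_eq_top, eq_top_iff, ← (Pi.basisFun R (Fin n)).span_eq, Submodule.span_le]
  rintro _ ⟨k, rfl⟩
  -- `e_k` is the image of `(x_{k+1} - 1) ⊗ e_1`.
  let z : augIdeal (n + 1) := ⟨MonoidAlgebra.of ℤ _ (FreeGroup.of k.succ) - 1, by
    simp [RingHom.mem_ker]⟩
  have hz : foxMap n t q z = Pi.single k (1 : R) := by
    rw [foxMap_apply, map_sub, map_one, burauAffineAlg_of, burauAffine_of_succ,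
      LinearMap.sub_apply, affineUnit_apply]
    simp
  refine ⟨1 ⊗ₜ Submodule.Quotient.mk ((1 ⊗ₜ Pi.single 1 1) ⊗ₜ z), ?_⟩
  rw [tauToBurau_tmul, lmToBurau_mk, coordOne_tmul, hz]
  simp

end Projection

end LongMoody

end

theorem theorem5p3 (n : ℕ) (hn : 3 ≤ n) :
    (∃ π : Representation.IntertwiningMap
        (LongMoody.tauLMqTYM LongMoody.tVar LongMoody.qVar n)
        (LongMoody.matrixRep (LongMoody.burau n (LongMoody.qVar ^ 2))),
      Function.Surjective π) ∧
    MonoidHom.ker (LongMoody.tauLMqTYM LongMoody.tVar LongMoody.qVar n) ≤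
      MonoidHom.ker (LongMoody.burau n (LongMoody.qVar ^ 2)) := by
  let π := (LongMoody.tauToBurau n LongMoody.tVar LongMoody.qVar).intertwiningMap_of_isIntertwiningMap
    (LongMoody.tauLMqTYM LongMoody.tVar LongMoody.qVar n)
    (LongMoody.matrixRep (LongMoody.burau n (LongMoody.qVar ^ 2)))
    (LongMoody.BraidGroup.comp_rep_of_generators _ _ _ (LongMoody.tauToBurau_σ n _ _))
  have hπ : Function.Surjective π := LongMoody.tauToBurau_surjective n _ _
  refine ⟨⟨π, hπ⟩, fun g hg => ?_⟩
  have h := LongMoody.ker_le_of_surjective_intertwining π hπ hg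
  rw [MonoidHom.mem_ker] at h ⊢
  refine Units.ext (LongMoody.matrix_ext_mulVec fun v r => ?_)
  rw [← LongMoody.matrixRep_apply, h, Units.val_one, Matrix.one_mulVec, Module.End.one_apply]
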